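/- Let $\lambda$ be the uniform (fair coin) measure on Cantor space $2^{\mathbb N}$. A Martin-Löf test is a computable sequence $(U_n)_{n\in\mathbb N}$ of open subsets of $2^{\mathbb N}$ with $\lambda(U_n)\le 2^{-n}$; it is universal if $\bigcap_n V_n\subseteq\bigcap_n U_n$ for every Martin-Löf test $(V_n)_n$. Let $\mathrm{MLR}=2^{\mathbb N}\setminus\bigcap_n U_n$ for a universal test $(U_n)_n$ (this set does not depend on the choice of the universal test, and consists of the sequences that lie in $\bigcap_n V_n$ for no Martin-Löf test $(V_n)_n$). For a universal Martin-Löf test $\mathcal U=(U_n)_n$ let $\mathrm{LAY}_{\mathcal U}:\mathrm{MLR}\rightrightarrows\mathbb N$ be the multivalued function with $n\in\mathrm{LAY}_{\mathcal U}(p)$ iff $p\notin U_n$. Let $\mathrm{Birkhoff}:\mathrm{MLR}\times\mathbb N\rightrightarrows\mathbb N$ be the multivalued function with $N\in\mathrm{Birkhoff}(p,k)$ iff for all $n\ge N$ $$\left|\left(\frac1{n+1}\sum_{i=0}^{n}\pi_1(S^i(p))\right)-\frac12\right|<2^{-k},$$ where $S$ is the shift on $2^{\mathbb N}$ and $\pi_1:2^{\mathbb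 N}\to\{0,1\}$ is the projection to the first bit. For represented spaces, a realizer of a multivalued function $f$ is a partial function $F:\subseteq\mathbb N^{\mathbb N}\to\mathbb N^{\mathbb N}$ that maps every name of every point $x$ in the domain of $f$ to a name of an element of $f(x)$. Write $f\le_W g$ if there are computable $K,H:\subseteq\mathbb N^{\mathbb N}\to\mathbb N^{\mathbb N}$ such that $p\mapsto K\langle p,G(H(p))\rangle$ is a realizer of $f$ for every realizer $G$ of $g$; and $f\equiv_W g$ if $f\le_W g$ and $g\le_W f$. Here $\mathrm{MLR}$, $\mathbb N$ and products carry their standard representations. Theorem. For every universal Martin-Löf test $\mathcal U$, the multivalued function $\mathrm{Birkhoff}$ is total, i.e. $\mathrm{Birkhoff}(p,k)\neq\emptyset$ for all $p\in\mathrm{MLR}$ and $k\in\mathbb N$, and $\mathrm{Birkhoff}\equiv_W\mathrm{LAY}_{\mathcal U}$. -/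

import Mathlib

namespace Weihrauch

/-! ### Computability on Baire space -/

/-- Baire space. -/
abbrev Baire : Type := ℕ → ℕ

/-- Cantor space. -/
abbrev Cantor : Type := ℕ → Bool

/-- The finite prefix of length `n` of an infinite sequence. -/
def initial {A : Type*} (p : ℕ → A) (n : ℕ) : List A := (List.range n).map p

/-- Type-2 computability of a partial function `F` on Baire space: some computable word function
`φ`, monotone for the prefix order, maps longer and longer prefixes of an input `p ∈ dom F` to
longer and longer prefixes of the output `F p`. By monotonicity of `φ`, the last clause says that
`F p` is the supremum of the words `φ (initial p n)`. As usual, a restriction of a computable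
partial function is computable. -/
def IsComputable (F : Baire →. Baire) : Prop :=
  ∃ φ : List ℕ → List ℕ, Computable φ ∧ (∀ v w, v <+: w → φ v <+: φ w) ∧
    ∀ p, ∀ q ∈ F p, ∀ m, ∃ n, (φ (initial p n))[m]? = some (q m)

/-- The standard pairing on Baire space: `p` on the even positions, `q` on the odd ones. -/
def pairing (p q : Baire) : Baire := fun n => if n % 2 = 0 then p (n / 2) else q (n / 2)

/-- The first component of a pair. -/
def evenPart (p : Baire) : Baire := fun n => p (2 * n)

/-- The second component of a pair. -/
def oddPart (p : Baire) : Baire := fun n => p (2 * n + 1)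

theorem evenPart_pairing (p q : Baire) : evenPart (pairing p q) = p := by
  funext n; simp [evenPart, pairing]

theorem oddPart_pairing (p q : Baire) : oddPart (pairing p q) = q := by
  funext n
  have h1 : (2 * n + 1) % 2 = 1 := by omega
  have h2 : (2 * n + 1) / 2 = n := by omega
  simp [oddPart, pairing, h1, h2]

/-! ### Represented spaces -/

/-- A represented space: a set with a partial surjection from Baire space onto it. -/
class Represented (X : Type*) where
  /-- The representation. -/
  rep : Baire →. X
  surj : ∀ x : X, ∃ p, x ∈ rep p

/-- The space `ℕ`: the number `n` is named by the sequences that start with `n`. -/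
instance instRepresentedNat : Represented ℕ where
  rep p := Part.some (p 0)
  surj n := ⟨fun _ => n, Part.mem_some _⟩

/-- Cantor space: each `0`-`1` sequence is its own name. -/
instance instRepresentedCantor : Represented Cantor where
  rep p := ⟨∀ n, p n ≤ 1, fun _ n => decide (p n = 1)⟩
  surj x := by
    refine ⟨fun n => (x n).toNat, fun n => Bool.toNat_le _, ?_⟩
    funext n
    cases h : x n <;> simp [h]

/-- A subset of a represented space, with the restricted representation. -/
instance instRepresentedSet {X : Type*} [Represented X] (A : Set X) : Represented A where
  rep p := ⟨∃ h : (Represented.rep (X := X) p).Dom, (Represented.rep (X := X) p).get h ∈ A,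
    fun h => ⟨(Represented.rep (X := X) p).get h.fst, h.snd⟩⟩
  surj x := by
    obtain ⟨p, hp, hx⟩ := Represented.surj (x : X)
    exact ⟨p, ⟨hp, hx ▸ x.2⟩, Subtype.ext hx⟩

/-- The product of two represented spaces: a pair of names is a name of the pair. -/
instance instRepresentedProd {X Y : Type*} [Represented X] [Represented Y] :
    Represented (X × Y) where
  rep p := ⟨(Represented.rep (X := X) (evenPart p)).Dom ∧
      (Represented.rep (X := Y) (oddPart p)).Dom,
    fun h => ((Represented.rep (X := X) (evenPart p)).get h.1,
      (Represented.rep (X := Y) (oddPart p)).get h.2)⟩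
  surj := by
    rintro ⟨x, y⟩
    obtain ⟨p, hx⟩ := Represented.surj x
    obtain ⟨q, hy⟩ := Represented.surj y
    rw [← evenPart_pairing p q] at hx
    rw [← oddPart_pairing p q] at hy
    obtain ⟨hp, hx⟩ := hx
    obtain ⟨hq, hy⟩ := hy
    exact ⟨pairing p q, ⟨hp, hq⟩, Prod.ext hx hy⟩

/-! ### Weihrauch reducibility

A (partial) multivalued function from `X` to `Y` is a map `f : X → Set Y`; its domain is the set
of all `x` for which `f x` is nonempty. -/

/-- `F` is a realizer of `f`: it maps every name of every `x` in the domain of `f` to a name of an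
element of `f x`. -/
def Realizes {X Y : Type*} [Represented X] [Represented Y]
    (F : Baire →. Baire) (f : X → Set Y) : Prop :=
  ∀ p, ∀ x ∈ Represented.rep (X := X) p, (f x).Nonempty →
    ∃ q ∈ F p, ∃ y ∈ Represented.rep (X := Y) q, y ∈ f x

/-- Weihrauch reducibility: there are computable `K`, `H` such that `p ↦ K ⟨p, G (H p)⟩` realizes
`f` for every realizer `G` of `g`. -/
def Reducible {X Y Z W : Type*} [Represented X] [Represented Y] [Represented Z] [Represented W]
    (f : X → Set Y) (g : Z → Set W) : Prop :=
  ∃ K H : Baire →. Baire, IsComputable K ∧ IsComputable H ∧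
    ∀ G : Baire →. Baire, Realizes G g →
      Realizes (fun p => (H p).bind fun r => (G r).bind fun s => K (pairing p s)) f

/-- Weihrauch equivalence. -/
def Equivalent {X Y Z W : Type*} [Represented X] [Represented Y] [Represented Z] [Represented W]
    (f : X → Set Y) (g : Z → Set W) : Prop :=
  Reducible f g ∧ Reducible g f

/-! ### Martin-Löf randomness -/

/-- The set of all infinite binary sequences that extend the finite word `w`. -/
def cylinder (w : List Bool) : Set Cantor := {p | initial p w.length = w}

/-- The uniform (fair coin) measure on Cantor space. -/
noncomputable def coinMeasure : MeasureTheory.Measure Cantor :=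
  MeasureTheory.Measure.infinitePi fun _ : ℕ => (PMF.uniformOfFintype Bool).toMeasure

/-- A computable sequence of open sets: uniformly in `i`, one can list (possibly finitely many)
words whose cylinders have the union `U i`. -/
def IsComputableOpenSeq (U : ℕ → Set Cantor) : Prop :=
  ∃ e : ℕ → ℕ → Option (List Bool), Computable₂ e ∧
    ∀ i, U i = {p | ∃ j, ∃ w, e i j = some w ∧ p ∈ cylinder w}

/-- Martin-Löf tests (not required to be nested). -/
def IsMLTest (U : ℕ → Set Cantor) : Prop :=
  IsComputableOpenSeq U ∧ ∀ i, coinMeasure (U i) ≤ (2 ^ i : ENNReal)⁻¹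

/-- Universal Martin-Löf tests. -/
def IsUniversalMLTest (U : ℕ → Set Cantor) : Prop :=
  IsMLTest U ∧ ∀ V, IsMLTest V → ⋂ i, V i ⊆ ⋂ i, U i

/-- The set of Martin-Löf random sequences: those which lie in the intersection of no test. -/
def MLR : Set Cantor := {p | ∀ V, IsMLTest V → p ∉ ⋂ i, V i}

/-- The random sequences are the complement of the intersection of any universal test. -/
theorem IsUniversalMLTest.mlr_eq {U : ℕ → Set Cantor} (hU : IsUniversalMLTest U) :
    MLR = (⋂ i, U i)ᶜ :=
  Set.Subset.antisymm (fun _ hp => hp U hU.1) fun _ hp V hV hpV => hp (hU.2 V hV hpV)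

/-- The layer problem of a test: given a random `p`, find some `n` with `p ∉ U n`. -/
def LAY (U : ℕ → Set Cantor) : MLR → Set ℕ := fun p => {n | (p : Cantor) ∉ U n}

/-! ### The convergence rate in Birkhoff's theorem -/

/-- The shift operator on Cantor space. -/
def shift (p : Cantor) : Cantor := fun n => p (n + 1)

/-- The projection to the first bit, as a real number. -/
def firstBit (p : Cantor) : ℝ := if p 0 then 1 else 0

/-- Given a random `p` and some `k`, find an `N` from which on the Birkhoff averages of `p` are
within less than `2 ^ (-k)` of `1 / 2`. -/
def Birkhoff : MLR × ℕ → Set ℕ := fun x =>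
  {N | ∀ n ≥ N, |(1 / ((n : ℝ) + 1)) * (∑ i ∈ Finset.range (n + 1), firstBit (shift^[i] x.1)) -
    1 / 2| < (2 : ℝ) ^ (-(x.2 : ℤ))}

end Weihrauch

/-!
Both reductions send a random sequence `p` to a sequence `q` that is a copy of `p` with finitely many
interventions. The output of such a copying machine (`run`) is random, because randomness depends on
the tail only (`mem_MLR_of_tail`), and it is a name that is computable from a name of `p`.

That there are only finitely many interventions on the side of the Birkhoff averages is the law of
large numbers for random sequences (`Birkhoff_nonempty`): by Hoeffding's inequality, the sets of the
sequences whose averages deviate at some late index form a Martin-Löf test.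

*Birkhoff to layers.* Copying alone would not do. Universality only says that `⋂ V i ⊆ ⋂ U i` for
every test `V`, so a layer `n` with `p ∉ U n` carries no bound that is uniform in `V`, and the rates of
the sequences outside `U n` may be unbounded. However, every `U i` is dense, as it contains all
sequences that are eventually zero. So the machine `driveInto`, whenever it sees an average of index
`s` deviate, extends its output to a word whose cylinder is contained in each of `U 0, …, U s`. If the
output `q` avoids `U n`, then no average of index `≥ n` deviates, and `n` itself is the answer.

*Layers to Birkhoff.* The machine `markLayers` keeps the least `c` such that `p` has not yet been seen
to lie in `U c`. Whenever it increases `c`, at time `s`, it writes so many zeros that an average of the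
output of index at least `s` deviates by `1/4`. As `p` is random, this happens finitely often. If `N`
bounds the Birkhoff rate of the output for `k = 2`, then `c` is constant from time `N` on, and so its
value at time `N`, which is computable from `p` and `N`, satisfies `p ∉ U c`.
-/

namespace Weihrauch

open MeasureTheory ProbabilityTheory
open scoped ENNReal NNReal

/-! ### The coin measure and the tails of random sequences -/

/-- The sequence obtained by writing the bit `b` in front of `p`. -/
def consBit (b : Bool) (p : Cantor) : Cantor := fun n => Nat.casesOn n b p

theorem consBit_shift (p : Cantor) : consBit (p 0) (shift p) = p := by
  funext n; cases n <;> rfl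

theorem measurable_shift : Measurable shift :=
  measurable_pi_lambda _ fun n => measurable_pi_apply (n + 1)

theorem measurable_consBit (b : Bool) : Measurable (consBit b) := by
  refine measurable_pi_lambda _ fun n => ?_
  cases n with
  | zero => exact measurable_const
  | succ n => exact measurable_pi_apply n

instance : IsProbabilityMeasure coinMeasure := by
  unfold coinMeasure; infer_instance

open Classical in
theorem map_consBit_box (b : Bool) (s : Finset ℕ) (t : ℕ → Set Bool) :
    coinMeasure.map (consBit b) ((s : Set ℕ).pi t) =
      (if 0 ∈ s → b ∈ t 0 then 1 else 0) *
        ∏ i ∈ s.erase 0, (PMF.uniformOfFintype Bool).toMeasure (t i) := by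
  have ht : ∀ i, MeasurableSet (t i) := fun i => (Set.toFinite _).measurableSet
  rw [Measure.map_apply (measurable_consBit b)
    (MeasurableSet.pi s.countable_toSet fun i _ => ht i)]
  split_ifs with h
  · have hpre : consBit b ⁻¹' ((s : Set ℕ).pi t) =
        ((s.preimage Nat.succ Nat.succ_injective.injOn : Finset ℕ) : Set ℕ).pi
          (fun i => t (i + 1)) := by
      ext p
      simp only [Set.mem_preimage, Set.mem_pi, Finset.mem_coe, Finset.mem_preimage]
      refine ⟨fun hp i hi => hp (i + 1) hi, fun hp i hi => ?_⟩
      cases i with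
      | zero => exact h hi
      | succ i => exact hp i hi
    rw [hpre, coinMeasure, Measure.infinitePi_pi _ fun i _ => ht _,
      Finset.prod_preimage' Nat.succ s Nat.succ_injective.injOn
        fun i => (PMF.uniformOfFintype Bool).toMeasure (t i), one_mul]
    refine Finset.prod_congr ?_ fun _ _ => rfl
    ext i
    simp [Nat.pos_iff_ne_zero, and_comm]
  · push Not at h
    have hpre : consBit b ⁻¹' ((s : Set ℕ).pi t) = ∅ := by
      ext p
      simp only [Set.mem_preimage, Set.mem_pi, Finset.mem_coe, Set.mem_empty_iff_false, iff_false]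
      exact fun hp => h.2 (hp 0 h.1)
    rw [hpre, measure_empty, zero_mul]

/-- The coin measure is the law of a fair bit followed by an independent sequence of law
`coinMeasure`. -/
theorem coinMeasure_eq_consBit :
    coinMeasure =
      (2⁻¹ : ℝ≥0∞) • (coinMeasure.map (consBit true) + coinMeasure.map (consBit false)) := by
  classical
  symm
  refine Measure.eq_infinitePi _ fun s t ht => ?_
  rw [Measure.smul_apply, Measure.add_apply, map_consBit_box, map_consBit_box, smul_eq_mul]
  by_cases h0 : 0 ∈ s
  · rw [← Finset.mul_prod_erase s _ h0, ← add_mul, ← mul_assoc]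
    congr 1
    rw [PMF.toMeasure_apply_fintype]
    simp only [h0, true_implies, Fintype.sum_bool, Set.indicator_apply,
      PMF.uniformOfFintype_apply, Fintype.card_bool, Nat.cast_ofNat, mul_add, mul_ite, mul_one,
      mul_zero]
  · rw [Finset.erase_eq_of_notMem h0, ← add_mul, ← mul_assoc]
    simp only [h0, false_implies, if_true, one_add_one_eq_two]
    rw [ENNReal.inv_mul_cancel (by simp) (by simp), one_mul]

theorem coinMeasure_preimage_consBit_le (b : Bool) (A : Set Cantor) :
    coinMeasure (consBit b ⁻¹' A) ≤ 2 * coinMeasure A := by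
  have h : coinMeasure (consBit b ⁻¹' A) ≤ coinMeasure.map (consBit b) A :=
    Measure.le_map_apply (measurable_consBit b).aemeasurable A
  refine h.trans ?_
  conv_rhs => rw [coinMeasure_eq_consBit]
  rw [Measure.smul_apply, Measure.add_apply, smul_eq_mul, ← mul_assoc,
    ENNReal.mul_inv_cancel (by simp) (by simp), one_mul]
  cases b
  · exact le_add_self
  · exact le_self_add

theorem coinMeasure_preimage_shift_le (A : Set Cantor) :
    coinMeasure (shift ⁻¹' A) ≤ coinMeasure A := by
  refine (Measure.le_map_apply measurable_shift.aemeasurable A).trans_eq ?_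
  have h := congrArg (Measure.map shift) coinMeasure_eq_consBit
  have hid : ∀ b, (coinMeasure.map (consBit b)).map shift = coinMeasure := fun b => by
    rw [Measure.map_map measurable_shift (measurable_consBit b)]
    exact Measure.map_id
  rw [Measure.map_smul, Measure.map_add _ _ measurable_shift, hid, hid, ← two_smul ℝ≥0∞,
    smul_smul, ENNReal.inv_mul_cancel (by simp) (by simp), one_smul] at h
  rw [h]

theorem initial_succ {A : Type*} (p : ℕ → A) (n : ℕ) :
    initial p (n + 1) = initial p n ++ [p n] := by
  simp [initial, List.range_succ]

@[simp] theorem length_initial {A : Type*} (p : ℕ → A) (n : ℕ) : (initial p n).length = n := by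
  simp [initial]

theorem initial_succ' (p : Cantor) (n : ℕ) :
    initial p (n + 1) = p 0 :: initial (shift p) n := by
  simp [initial, List.range_succ_eq_map, shift, Function.comp_def]

theorem mem_cylinder_cons {b : Bool} {w : List Bool} {p : Cantor} :
    p ∈ cylinder (b :: w) ↔ p 0 = b ∧ shift p ∈ cylinder w := by
  simp [cylinder, initial_succ']

theorem mem_cylinder_nil (p : Cantor) : p ∈ cylinder [] := by
  simp [cylinder, initial]

/-- The random sequences are closed under deleting the first bit. -/
theorem shift_mem_MLR {p : Cantor} (hp : p ∈ MLR) : shift p ∈ MLR := by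
  rintro V ⟨⟨e, he, hV⟩, hm⟩ hpV
  refine hp (fun i => shift ⁻¹' V i) ⟨⟨fun i j => (e i j.div2).map (List.cons j.bodd), ?_, ?_⟩,
    fun i => (coinMeasure_preimage_shift_le _).trans (hm i)⟩ (by simpa using hpV)
  · refine Computable.option_map (he.comp Computable.fst (Computable.nat_div2.comp Computable.snd))
      (Computable.list_cons.comp ?_ Computable.snd)
    exact (Computable.nat_bodd.comp Computable.snd).comp Computable.fst
  · intro i
    ext q
    simp only [hV i, Set.mem_preimage, Set.mem_ofPred_eq, Option.map_eq_some_iff]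
    constructor
    · rintro ⟨j, w, hj, hw⟩
      refine ⟨Nat.bit (q 0) j, q 0 :: w, ⟨w, ?_, ?_⟩, mem_cylinder_cons.2 ⟨rfl, hw⟩⟩
      · rw [Nat.div2_bit, hj]
      · rw [Nat.bodd_bit]
    · rintro ⟨j, _, ⟨w, hj, rfl⟩, hw⟩
      exact ⟨_, w, hj, (mem_cylinder_cons.1 hw).2⟩

/-- The random sequences are closed under writing a bit in front: a test for `consBit b p`,
shifted by one level to make up for the factor `2` in measure, is a test for `p`. -/
theorem consBit_mem_MLR (b : Bool) {p : Cantor} (hp : p ∈ MLR) : consBit b p ∈ MLR := by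
  rintro V ⟨⟨e, he, hV⟩, hm⟩ hpV
  refine hp (fun i => consBit b ⁻¹' V (i + 1))
    ⟨⟨fun i j => (e (i + 1) j).bind fun w => if w.headI = b ∨ w = [] then some w.tail else none,
      ?_, ?_⟩, fun i => ?_⟩ ?_
  · refine Computable.option_bind
      (he.comp (Computable.succ.comp Computable.fst) Computable.snd) ?_
    refine Primrec.to_comp (f := fun x : (ℕ × ℕ) × List Bool =>
      if x.2.headI = b ∨ x.2 = [] then some x.2.tail else none) ?_
    refine Primrec.ite (PrimrecPred.or ?_ ?_) (Primrec.option_some.comp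
      (Primrec.list_tail.comp Primrec.snd)) (Primrec.const _)
    · exact Primrec.eq.comp (Primrec.list_headI.comp Primrec.snd) (Primrec.const b)
    · exact Primrec.eq.comp Primrec.snd (Primrec.const _)
  · intro i
    ext q
    simp only [hV (i + 1), Set.mem_preimage, Set.mem_ofPred_eq, Option.bind_eq_some_iff]
    constructor
    · rintro ⟨j, w, hj, hw⟩
      refine ⟨j, w.tail, ⟨w, hj, ?_⟩, ?_⟩
      · cases w with
        | nil => simp
        | cons a w => simp [(mem_cylinder_cons.1 hw).1.symm, consBit]
      · cases w with
        | nil => exact mem_cylinder_nil q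
        | cons a w => exact (mem_cylinder_cons.1 hw).2
    · rintro ⟨j, w', ⟨w, hj, h⟩, hw⟩
      split_ifs at h with hb
      cases Option.some_injective _ h
      refine ⟨j, w, hj, ?_⟩
      cases w with
      | nil => exact mem_cylinder_nil _
      | cons a w =>
        refine mem_cylinder_cons.2 ⟨?_, hw⟩
        simpa [consBit, eq_comm] using hb
  · refine (coinMeasure_preimage_consBit_le _ _).trans ((mul_le_mul_right (hm (i + 1)) 2).trans_eq ?_)
    rw [pow_succ, ENNReal.mul_inv (by simp) (by simp), mul_comm, mul_assoc,
      ENNReal.inv_mul_cancel (by simp) (by simp), mul_one]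
  · simp only [Set.mem_iInter, Set.mem_preimage] at hpV ⊢
    exact fun i => hpV (i + 1)

theorem shift_iterate_apply (p : Cantor) (m n : ℕ) : shift^[m] p n = p (m + n) := by
  induction m generalizing n with
  | zero => simp
  | succ m ih => rw [Function.iterate_succ_apply', shift, ih]; congr 1; omega

/-- Randomness depends on the tail only, even when the tail is moved. -/
theorem mem_MLR_of_tail {p q : Cantor} (hp : p ∈ MLR) {m l : ℕ}
    (h : ∀ n, q (l + n) = p (m + n)) : q ∈ MLR := by
  have hq : shift^[l] q ∈ MLR := by
    have : shift^[l] q = shift^[m] p := by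
      funext n; rw [shift_iterate_apply, shift_iterate_apply, h]
    rw [this]
    clear h this
    induction m with
    | zero => exact hp
    | succ m ih => rw [Function.iterate_succ_apply']; exact shift_mem_MLR ih
  clear h
  induction l with
  | zero => exact hq
  | succ l ih =>
    refine ih ?_
    rw [← consBit_shift (shift^[l] q), ← Function.iterate_succ_apply' shift]
    exact consBit_mem_MLR _ hq

/-! ### The law of large numbers for random sequences -/

/-- The relative frequency of `true` in the word `w` is at distance at least `2 ^ (-k)` from `1/2`;
written without division, so that it also holds of the empty word. -/
def Deviates (k : ℕ) (w : List Bool) : Prop :=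
  2 * w.length + 2 ^ k * w.length ≤ 2 ^ k * (2 * w.count true) ∨
    2 ^ k * (2 * w.count true) + 2 * w.length ≤ 2 ^ k * w.length

instance (k : ℕ) (w : List Bool) : Decidable (Deviates k w) := by
  unfold Deviates; infer_instance

theorem primrec_two_pow : Primrec fun k : ℕ => 2 ^ k :=
  (Primrec.nat_rec₁ 1 (f := fun _ m => 2 * m)
    (Primrec.nat_mul.comp (Primrec.const 2) Primrec.snd)).of_eq fun n => by
      induction n with
      | zero => rfl
      | succ n ih => rw [pow_succ, ← ih, mul_comm]

theorem primrecRel_deviates : PrimrecRel Deviates := by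
  have hlen : Primrec fun x : ℕ × List Bool => x.2.length := Primrec.list_length.comp Primrec.snd
  have hcount : Primrec fun x : ℕ × List Bool => 2 * x.2.count true := by
    refine Primrec.nat_mul.comp (Primrec.const 2) ?_
    refine (Primrec.list_length.comp ((Primrec.listFilter (p := fun b : Bool => b = true)
      (Primrec.eq.comp Primrec.id (Primrec.const true))).comp Primrec.snd)).of_eq fun x => ?_
    rw [List.count_eq_length_filter]
    congr 2
  have hpow : Primrec fun x : ℕ × List Bool => 2 ^ x.1 := primrec_two_pow.comp Primrec.fst
  have h2 : Primrec fun x : ℕ × List Bool => 2 * x.2.length :=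
    Primrec.nat_mul.comp (Primrec.const 2) hlen
  exact PrimrecPred.or
    (Primrec.nat_le.comp (Primrec.nat_add.comp h2 (Primrec.nat_mul.comp hpow hlen))
      (Primrec.nat_mul.comp hpow hcount))
    (Primrec.nat_le.comp (Primrec.nat_add.comp (Primrec.nat_mul.comp hpow hcount) h2)
      (Primrec.nat_mul.comp hpow hlen))

theorem sum_firstBit (p : Cantor) (n : ℕ) :
    ∑ i ∈ Finset.range n, firstBit (shift^[i] p) = ((initial p n).count true : ℝ) := by
  induction n with
  | zero => simp [initial]
  | succ n ih =>
    rw [Finset.sum_range_succ, ih, initial_succ, List.count_append, firstBit, shift_iterate_apply]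
    cases p n <;> simp

theorem deviates_iff_abs (k n : ℕ) (p : Cantor) :
    Deviates k (initial p (n + 1)) ↔
      (2 : ℝ)⁻¹ ^ k * ((n : ℝ) + 1) ≤ |((initial p (n + 1)).count true : ℝ) - ((n : ℝ) + 1) / 2| := by
  have h2 : (0 : ℝ) < 2 ^ k := by positivity
  rw [Deviates, length_initial, le_abs, inv_pow, inv_mul_le_iff₀ h2, inv_mul_le_iff₀ h2]
  refine or_congr ?_ ?_
  · rw [← Nat.cast_le (α := ℝ)]
    push_cast
    constructor <;> intro h <;> linarith
  · rw [← Nat.cast_le (α := ℝ)]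
    push_cast
    constructor <;> intro h <;> linarith

theorem mem_Birkhoff_iff {x : MLR × ℕ} {N : ℕ} :
    N ∈ Birkhoff x ↔ ∀ n ≥ N, ¬ Deviates x.2 (initial x.1 (n + 1)) := by
  refine forall₂_congr fun n _ => ?_
  rw [deviates_iff_abs, sum_firstBit, not_le]
  have hn : (0 : ℝ) < (n : ℝ) + 1 := by positivity
  rw [zpow_neg, zpow_natCast, ← inv_pow, ← div_lt_iff₀ hn, ← abs_of_pos hn, ← abs_div,
    abs_of_pos hn]
  have : 1 / ((n : ℝ) + 1) * ((initial (x.1 : Cantor) (n + 1)).count true : ℝ) - 1 / 2 =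
      (((initial (x.1 : Cantor) (n + 1)).count true : ℝ) - ((n : ℝ) + 1) / 2) / ((n : ℝ) + 1) := by
    field_simp
  rw [this]

/-- The `i`-th bit, centred. -/
noncomputable def centredBit (i : ℕ) (p : Cantor) : ℝ := if p i then 1 / 2 else -(1 / 2)

theorem sum_centredBit (p : Cantor) (n : ℕ) :
    ∑ i ∈ Finset.range n, centredBit i p = ((initial p n).count true : ℝ) - (n : ℝ) / 2 := by
  induction n with
  | zero => simp [initial]
  | succ n ih =>
    rw [Finset.sum_range_succ, ih, initial_succ, List.count_append, centredBit]
    cases h : p n <;> simp <;> ring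

theorem measurable_bit_ite (a b : ℝ) : Measurable fun x : Bool => if x then a else b :=
  measurable_of_countable _

theorem iIndepFun_centredBit : iIndepFun centredBit coinMeasure :=
  iIndepFun_infinitePi (X := fun _ (b : Bool) => if b then (1 / 2 : ℝ) else -(1 / 2))
    fun _ => measurable_bit_ite _ _

theorem measurable_centredBit (i : ℕ) : Measurable (centredBit i) :=
  (measurable_bit_ite _ _).comp (measurable_pi_apply i)

theorem integral_centredBit (i : ℕ) : ∫ p, centredBit i p ∂coinMeasure = 0 := by
  have h := integral_map (μ := coinMeasure) (φ := fun p : Cantor => p i)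
    (measurable_pi_apply i).aemeasurable
    (f := fun b : Bool => if b then (1 / 2 : ℝ) else -(1 / 2))
    (measurable_bit_ite _ _).aestronglyMeasurable
  rw [coinMeasure, Measure.infinitePi_map_eval, PMF.integral_eq_sum] at h
  rw [coinMeasure]
  refine h.symm.trans ?_
  simp

theorem hasSubgaussianMGF_centredBit (i : ℕ) :
    HasSubgaussianMGF (centredBit i) ((‖(1 / 2 : ℝ) - -(1 / 2)‖₊ / 2) ^ 2) coinMeasure := by
  refine hasSubgaussianMGF_of_mem_Icc_of_integral_eq_zero (measurable_centredBit i).aemeasurable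
    (Filter.Eventually.of_forall fun p => ?_) (integral_centredBit i)
  rw [centredBit]
  split_ifs <;> constructor <;> norm_num

/-- The Hoeffding bound, which makes the measures of the deviations geometrically small. -/
theorem measureReal_deviates_le (k n : ℕ) :
    coinMeasure.real {p | Deviates k (initial p (n + 1))} ≤
      2 * Real.exp (-2 * ((2 : ℝ)⁻¹ ^ k) ^ 2) ^ (n + 1) := by
  set ε : ℝ := (2 : ℝ)⁻¹ ^ k * ((n + 1 : ℕ) : ℝ) with hε
  have hε0 : 0 ≤ ε := by positivity
  have hexp : Real.exp (-ε ^ 2 / (2 * ((n + 1 : ℕ) : ℝ) *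
      (((‖(1 / 2 : ℝ) - -(1 / 2)‖₊ / 2) ^ 2 : ℝ≥0) : ℝ))) =
        Real.exp (-2 * ((2 : ℝ)⁻¹ ^ k) ^ 2) ^ (n + 1) := by
    rw [← Real.exp_nat_mul]
    congr 1
    have : (((‖(1 / 2 : ℝ) - -(1 / 2)‖₊ / 2) ^ 2 : ℝ≥0) : ℝ) = 1 / 4 := by
      push_cast
      norm_num
    rw [this, hε]
    have hn : ((n + 1 : ℕ) : ℝ) ≠ 0 := by positivity
    field_simp
    ring
  have h1 := HasSubgaussianMGF.measure_sum_range_ge_le_of_iIndepFun iIndepFun_centredBit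
    (n := n + 1) (fun i _ => hasSubgaussianMGF_centredBit i) hε0
  have h2 := HasSubgaussianMGF.measure_sum_range_ge_le_of_iIndepFun
    (X := fun i p => -centredBit i p)
    (iIndepFun_centredBit.comp (fun _ x => -x) fun _ => measurable_neg)
    (n := n + 1) (fun i _ => (hasSubgaussianMGF_centredBit i).neg) hε0
  rw [hexp] at h1 h2
  refine (measureReal_mono ?_).trans ((measureReal_union_le _ _).trans (add_le_add h1 h2)) |>.trans
    (two_mul _).symm.le
  intro p hp
  rw [Set.mem_ofPred_eq, deviates_iff_abs, le_abs] at hp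
  simp only [Set.mem_union, Set.mem_ofPred_eq, Finset.sum_neg_distrib, sum_centredBit, hε]
  push_cast
  exact hp

/-- The effective strong law of large numbers: the sequences that deviate at some index `≥ c * (i + d)`
form the `i`-th level of a test, for suitable constants `c` and `d`. -/
theorem Birkhoff_nonempty (x : MLR × ℕ) : (Birkhoff x).Nonempty := by
  obtain ⟨p, k⟩ := x
  set r := Real.exp (-2 * ((2 : ℝ)⁻¹ ^ k) ^ 2) with hr
  have hr0 : 0 < r := Real.exp_pos _
  have hr1 : r < 1 := by
    rw [hr, Real.exp_lt_one_iff]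
    have : (0 : ℝ) < ((2 : ℝ)⁻¹ ^ k) ^ 2 := by positivity
    linarith
  obtain ⟨c, hc⟩ := exists_pow_lt_of_lt_one (show (0 : ℝ) < 2⁻¹ by norm_num) hr1
  obtain ⟨d, hd⟩ := exists_pow_lt_of_lt_one (show (0 : ℝ) < (1 - r) / 2 by linarith)
    (show (2 : ℝ)⁻¹ < 1 by norm_num)
  by_contra hne
  have hinf : ∀ N, ∃ n ≥ N, Deviates k (initial (p : Cantor) (n + 1)) := by
    intro N
    by_contra h
    push Not at h
    exact hne ⟨N, mem_Birkhoff_iff.2 h⟩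
  refine p.2 (fun i => ⋃ n, {q | Deviates k (initial q (c * (i + d) + n + 1))})
    ⟨⟨fun i j => (Encodable.decode (α := List Bool) j).bind fun w =>
      if c * (i + d) + 1 ≤ w.length ∧ Deviates k w then some w else none, ?_, fun i => ?_⟩,
      fun i => ?_⟩ ?_
  · refine Primrec.to_comp (Primrec.option_bind (Primrec.decode.comp Primrec.snd) ?_)
    refine Primrec.ite (PrimrecPred.and ?_ ?_) (Primrec.option_some.comp Primrec.snd)
      (Primrec.const _)
    · refine Primrec.nat_le.comp (Primrec.succ.comp (Primrec.nat_mul.comp (Primrec.const c)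
        (Primrec.nat_add.comp (Primrec.fst.comp Primrec.fst) (Primrec.const d))))
        (Primrec.list_length.comp Primrec.snd)
    · exact primrecRel_deviates.comp (Primrec.const k) Primrec.snd
  · ext q
    simp only [Set.mem_iUnion, Set.mem_ofPred_eq, Option.bind_eq_some_iff]
    constructor
    · rintro ⟨n, hn⟩
      refine ⟨Encodable.encode (initial q (c * (i + d) + n + 1)),
        initial q (c * (i + d) + n + 1), ⟨_, Encodable.encodek _, if_pos ⟨?_, hn⟩⟩, ?_⟩
      · rw [cylinder, Set.mem_ofPred_eq, length_initial]
      · rw [length_initial]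
        omega
    · rintro ⟨j, w, ⟨w', hj, h⟩, hw⟩
      split_ifs at h with hb
      obtain rfl : w' = w := Option.some_injective _ h
      refine ⟨w'.length - (c * (i + d) + 1), ?_⟩
      have : c * (i + d) + (w'.length - (c * (i + d) + 1)) + 1 = w'.length := by omega
      rw [this, show initial q w'.length = w' from hw]
      exact hb.2
  · have hsum : HasSum (fun n : ℕ => 2 * r ^ (c * (i + d) + 1) * r ^ n)
        (2 * r ^ (c * (i + d) + 1) * (1 - r)⁻¹) :=
      (hasSum_geometric_of_lt_one hr0.le hr1).mul_left _
    calc coinMeasure (⋃ n, {q | Deviates k (initial q (c * (i + d) + n + 1))})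
        ≤ ∑' n, coinMeasure {q | Deviates k (initial q (c * (i + d) + n + 1))} :=
          measure_iUnion_le _
      _ ≤ ∑' n, ENNReal.ofReal (2 * r ^ (c * (i + d) + 1) * r ^ n) := by
          refine ENNReal.tsum_le_tsum fun n => ?_
          rw [← ofReal_measureReal]
          refine ENNReal.ofReal_le_ofReal ((measureReal_deviates_le k _).trans_eq ?_)
          rw [← hr]
          ring
      _ = ENNReal.ofReal (2 * r ^ (c * (i + d) + 1) * (1 - r)⁻¹) := by
          rw [← ENNReal.ofReal_tsum_of_nonneg (fun n => by positivity) hsum.summable,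
            hsum.tsum_eq]
      _ ≤ ENNReal.ofReal ((2 : ℝ)⁻¹ ^ i) := by
          refine ENNReal.ofReal_le_ofReal ?_
          have h1r : 0 < 1 - r := by linarith
          rw [← div_eq_mul_inv, div_le_iff₀ h1r]
          calc 2 * r ^ (c * (i + d) + 1) ≤ 2 * r ^ (c * (i + d)) := by
                have := pow_le_pow_of_le_one hr0.le hr1.le (Nat.le_add_right (c * (i + d)) 1)
                linarith
            _ ≤ 2 * (2⁻¹ : ℝ) ^ (i + d) := by
                rw [pow_mul]
                have := pow_le_pow_left₀ (by positivity) hc.le (i + d)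
                linarith
            _ = (2⁻¹ : ℝ) ^ i * (2 * 2⁻¹ ^ d) := by rw [pow_add]; ring
            _ ≤ (2⁻¹ : ℝ) ^ i * (1 - r) := by
                refine mul_le_mul_of_nonneg_left ?_ (by positivity)
                linarith
      _ = (2 ^ i : ℝ≥0∞)⁻¹ := by
          rw [ENNReal.ofReal_pow (by norm_num), ENNReal.ofReal_inv_of_pos (by norm_num),
            ENNReal.ofReal_ofNat, ENNReal.inv_pow]
  · refine Set.mem_iInter.2 fun i => Set.mem_iUnion.2 ?_
    obtain ⟨n, hn, h⟩ := hinf (c * (i + d))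
    refine ⟨n - c * (i + d), ?_⟩
    rwa [Set.mem_ofPred_eq, Nat.add_sub_cancel' hn]

/-! ### Computable functions given by word functions and by copying machines -/

/-- The partial function on Baire space that is computed by the word function `φ`. -/
noncomputable def ofWord (φ : List ℕ → List ℕ) : Baire →. Baire := fun p =>
  ⟨∃ q : Baire, ∀ m, ∃ n, (φ (initial p n))[m]? = some (q m), Exists.choose⟩

theorem isComputable_ofWord {φ : List ℕ → List ℕ} (hφ : Computable φ)
    (hmono : ∀ v w, v <+: w → φ v <+: φ w) : IsComputable (ofWord φ) :=
  ⟨φ, hφ, hmono, fun _ _ ⟨h, hq⟩ => hq ▸ h.choose_spec⟩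

theorem initial_prefix {A : Type*} (p : ℕ → A) {m n : ℕ} (h : m ≤ n) :
    initial p m <+: initial p n := by
  induction n, h using Nat.le_induction with
  | base => exact List.prefix_rfl
  | succ n _ ih => exact ih.trans (initial_succ p n ▸ List.prefix_append _ _)

theorem getElem?_initial {A : Type*} (p : ℕ → A) {m n : ℕ} (h : m < n) :
    (initial p n)[m]? = some (p m) := by
  simp [initial, h]

theorem getD_initial {A : Type*} (p : ℕ → A) {m n : ℕ} (h : m < n) (d : A) :
    (initial p n).getD m d = p m := by
  rw [List.getD_eq_getElem?_getD, getElem?_initial p h, Option.getD_some]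

theorem getElem?_of_prefix {A : Type*} {v w : List A} (h : v <+: w) {m : ℕ} {a : A}
    (ha : v[m]? = some a) : w[m]? = some a := by
  obtain ⟨t, rfl⟩ := h
  rw [List.getElem?_append_left (List.getElem?_eq_some_iff.1 ha).1, ha]

theorem eq_initial_of_prefix {A : Type*} {w : List A} {q : ℕ → A} {n : ℕ} (h : w <+: initial q n) :
    w = initial q w.length := by
  have hle : w.length ≤ n := by simpa using h.length_le
  exact (List.prefix_of_prefix_length_le h (initial_prefix q hle) (by simp)).eq_of_length (by simp)

theorem mem_ofWord {φ : List ℕ → List ℕ} (hmono : ∀ v w, v <+: w → φ v <+: φ w) {p q : Baire}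
    (h : ∀ m, ∃ n, (φ (initial p n))[m]? = some (q m)) : q ∈ ofWord φ p := by
  refine ⟨⟨q, h⟩, funext fun m => ?_⟩
  have hex : ∃ q : Baire, ∀ m, ∃ n, (φ (initial p n))[m]? = some (q m) := ⟨q, h⟩
  obtain ⟨n₁, h₁⟩ := hex.choose_spec m
  obtain ⟨n₂, h₂⟩ := h m
  have h₁' := getElem?_of_prefix (hmono _ _ (initial_prefix p (le_max_left n₁ n₂))) h₁
  have h₂' := getElem?_of_prefix (hmono _ _ (initial_prefix p (le_max_right n₁ n₂))) h₂
  exact Option.some_injective _ (h₁'.symm.trans h₂')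

theorem getD_of_prefix {A : Type*} {v w : List A} (h : v <+: w) {m : ℕ} (hm : m < v.length)
    (d : A) : w.getD m d = v.getD m d := by
  obtain ⟨t, rfl⟩ := h
  exact List.getD_append _ _ _ _ hm

section Machine

variable {σ : Type*}

/-- A transition function: from the time `s`, a prefix of the input, the output so far and the
internal state, it computes the bits to append to the output and the new internal state. -/
abbrev Transition (σ : Type*) := ℕ → List ℕ → List Bool × σ → List Bool × σ

/-- The output and the internal state after `s` steps on the input `ν`. The step at time `s` sees
the first `2 * s + 2` entries of the input, so that it sees `s + 1` entries of either component if
the input is a pair. -/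
def run (step : Transition σ) (c₀ : σ) (ν : Baire) : ℕ → List Bool × σ
  | 0 => ([], c₀)
  | s + 1 => ((run step c₀ ν s).1 ++ (step s (initial ν (2 * s + 2)) (run step c₀ ν s)).1,
      (step s (initial ν (2 * s + 2)) (run step c₀ ν s)).2)

variable {step : Transition σ} {c₀ : σ}

theorem run_congr {ν ν' : Baire} {s : ℕ} (h : ∀ i < 2 * s, ν i = ν' i) :
    run step c₀ ν s = run step c₀ ν' s := by
  induction s with
  | zero => rfl
  | succ s ih =>
    have hi : initial ν (2 * s + 2) = initial ν' (2 * s + 2) :=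
      List.map_congr_left fun i hi => h i (List.mem_range.1 hi)
    rw [run, run, ih fun i hi => h i (by omega), hi]

theorem run_prefix (ν : Baire) {s t : ℕ} (h : s ≤ t) :
    (run step c₀ ν s).1 <+: (run step c₀ ν t).1 := by
  induction t, h using Nat.le_induction with
  | base => exact List.prefix_rfl
  | succ t _ ih => exact ih.trans (List.prefix_append _ _)

theorem primrec_initial {α A : Type*} [Primcodable α] [Primcodable A] {f : α → ℕ → A} {n : α → ℕ}
    (hf : Primrec₂ f) (hn : Primrec n) : Primrec fun a => initial (f a) (n a) :=
  Primrec.list_map (Primrec.list_range.comp hn) hf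

theorem computable_run {α : Type*} [Primcodable α] [Primcodable σ]
    (hstep : Computable fun x : (ℕ × List ℕ) × (List Bool × σ) => step x.1.1 x.1.2 x.2)
    {f : α → ℕ → ℕ} (hf : Primrec₂ f) {n : α → ℕ} (hn : Primrec n) :
    Computable fun a => run step c₀ (f a) (n a) := by
  have hin : Primrec fun x : α × (ℕ × (List Bool × σ)) => initial (f x.1) (2 * x.2.1 + 2) :=
    primrec_initial (f := fun (x : α × (ℕ × (List Bool × σ))) i => f x.1 i)
      (hf.comp (Primrec.fst.comp Primrec.fst) Primrec.snd)
      (Primrec.nat_add.comp (Primrec.nat_mul.comp (Primrec.const 2)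
        (Primrec.fst.comp Primrec.snd)) (Primrec.const 2))
  have hst : Computable fun x : α × (ℕ × (List Bool × σ)) =>
      step x.2.1 (initial (f x.1) (2 * x.2.1 + 2)) x.2.2 :=
    hstep.comp (((Primrec.fst.comp Primrec.snd).pair hin).pair
      (Primrec.snd.comp Primrec.snd)).to_comp
  have hnext : Computable fun x : α × (ℕ × (List Bool × σ)) =>
      (x.2.2.1 ++ (step x.2.1 (initial (f x.1) (2 * x.2.1 + 2)) x.2.2).1,
        (step x.2.1 (initial (f x.1) (2 * x.2.1 + 2)) x.2.2).2) :=
    (Computable.list_append.comp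
      (Primrec.fst.comp (Primrec.snd.comp Primrec.snd)).to_comp
      (Computable.fst.comp hst)).pair (Computable.snd.comp hst)
  refine (Computable.nat_rec hn.to_comp (Computable.const (([] : List Bool), c₀))
    hnext.to₂).of_eq fun a => ?_
  induction n a with
  | zero => rfl
  | succ s ih => rw [run, ← ih]

/-- The word function of a machine whose output bits are encoded by `g`. -/
def machineWord (step : Transition σ) (c₀ : σ) (g : List Bool → List ℕ) (v : List ℕ) : List ℕ :=
  g (run step c₀ (fun i => v.getD i 0) (v.length / 2)).1

theorem machineWord_mono {g : List Bool → List ℕ} (hg : ∀ v w, v <+: w → g v <+: g w)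
    (v w : List ℕ) (h : v <+: w) : machineWord step c₀ g v <+: machineWord step c₀ g w := by
  refine hg _ _ ?_
  rw [run_congr (ν := fun i => v.getD i 0) (ν' := fun i => w.getD i 0) fun i hi =>
    (getD_of_prefix h (by omega) 0).symm]
  exact run_prefix _ (Nat.div_le_div_right h.length_le)

theorem computable_machineWord [Primcodable σ]
    (hstep : Computable fun x : (ℕ × List ℕ) × (List Bool × σ) => step x.1.1 x.1.2 x.2)
    {g : List Bool → List ℕ} (hg : Primrec g) : Computable (machineWord step c₀ g) :=
  hg.to_comp.comp (Computable.fst.comp (computable_run hstep (Primrec.list_getD 0)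
    (Primrec.nat_div.comp Primrec.list_length (Primrec.const 2))))

theorem machineWord_initial (g : List Bool → List ℕ) (ν : Baire) (s : ℕ) :
    machineWord step c₀ g (initial ν (2 * s)) = g (run step c₀ ν s).1 := by
  rw [machineWord, length_initial, Nat.mul_div_cancel_left s two_pos,
    run_congr (ν := fun i => (initial ν (2 * s)).getD i 0) fun i hi => getD_initial ν hi 0]

/-- If a machine eventually does nothing but copy the random sequence `x`, then its output is
random. -/
theorem exists_mem_MLR_of_eventually_copy {ν : Baire} {x : Cantor} (hx : x ∈ MLR) {s₀ : ℕ}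
    (h : ∀ s ≥ s₀, (run step c₀ ν (s + 1)).1 = (run step c₀ ν s).1 ++ [x s]) :
    ∃ q ∈ MLR, (∀ s, (run step c₀ ν s).1 = initial q (run step c₀ ν s).1.length) ∧
      ∀ m, ∃ s, m < (run step c₀ ν s).1.length := by
  set u := (run step c₀ ν s₀).1 with hu
  let q : Cantor := fun n => if n < u.length then u.getD n false else x (s₀ + (n - u.length))
  have hq : ∀ n, q (u.length + n) = x (s₀ + n) := fun n => by simp [q]
  have hout : ∀ t, (run step c₀ ν (s₀ + t)).1 = initial q (u.length + t) := by
    intro t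
    induction t with
    | zero =>
      refine List.ext_getElem? fun i => ?_
      rw [add_zero, add_zero, ← hu]
      rcases lt_or_ge i u.length with hi | hi
      · rw [getElem?_initial _ hi]
        simp [q, hi]
      · rw [List.getElem?_eq_none hi, List.getElem?_eq_none (by simpa using hi)]
    | succ t ih =>
      rw [← add_assoc, h _ (by omega), ih, ← add_assoc, initial_succ, hq]
  refine ⟨q, mem_MLR_of_tail hx hq, fun s => ?_, fun m => ⟨s₀ + (m + 1), ?_⟩⟩
  · refine eq_initial_of_prefix (n := u.length + s) ?_
    rw [← hout]
    exact run_prefix _ (by omega)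
  · rw [hout, length_initial]
    omega

end Machine

/-- The name of a binary sequence. -/
def cantorName (q : Cantor) : Baire := fun n => (q n).toNat

theorem mem_rep_cantorName {q : Cantor} (hq : q ∈ MLR) :
    (⟨q, hq⟩ : MLR) ∈ Represented.rep (X := MLR) (cantorName q) := by
  have h : (fun n => decide ((q n).toNat = 1)) = q := by
    funext n; cases q n <;> rfl
  refine ⟨⟨fun n => Bool.toNat_le _, ?_⟩, Subtype.ext h⟩
  exact (congrArg (· ∈ MLR) h).mpr hq

theorem apply_of_mem_rep {p : MLR} {ν : Baire} (h : p ∈ Represented.rep (X := MLR) ν) (n : ℕ) :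
    decide (ν n = 1) = (p : Cantor) n := by
  obtain ⟨h, rfl⟩ := h
  rfl

theorem mem_rep_prod {X Y : Type*} [Represented X] [Represented Y] {x : X × Y} {ν : Baire} :
    x ∈ Represented.rep (X := X × Y) ν ↔
      x.1 ∈ Represented.rep (X := X) (evenPart ν) ∧ x.2 ∈ Represented.rep (X := Y) (oddPart ν) := by
  constructor
  · rintro ⟨h, rfl⟩
    exact ⟨⟨h.1, rfl⟩, ⟨h.2, rfl⟩⟩
  · rintro ⟨⟨h1, e1⟩, ⟨h2, e2⟩⟩
    exact ⟨⟨h1, h2⟩, Prod.ext e1 e2⟩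

theorem mem_rep_nat {n : ℕ} {ν : Baire} : n ∈ Represented.rep (X := ℕ) ν ↔ n = ν 0 :=
  Part.mem_some_iff

/-! ### Non-randomness and density of universal tests -/

/-- The zero sequence is not random, since it violates the law of large numbers. -/
theorem const_false_notMem_MLR : (fun _ => false : Cantor) ∉ MLR := by
  intro h
  obtain ⟨N, hN⟩ := Birkhoff_nonempty (⟨_, h⟩, 1)
  refine mem_Birkhoff_iff.1 hN N le_rfl (Or.inr ?_)
  have : (initial (fun _ => false : Cantor) (N + 1)).count true = 0 :=
    List.count_eq_zero.2 (by simp [initial])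
  change 2 ^ 1 * (2 * (initial (fun _ => false : Cantor) (N + 1)).count true) + _ ≤ _
  simp [this]

/-- The open sets of a universal test are dense, since their intersection contains all sequences
that are eventually zero. -/
theorem IsUniversalMLTest.exists_compatible {U : ℕ → Set Cantor} (hU : IsUniversalMLTest U)
    {e : ℕ → ℕ → Option (List Bool)}
    (he : ∀ i, U i = {p | ∃ j, ∃ w, e i j = some w ∧ p ∈ cylinder w}) (i : ℕ) (u : List Bool) :
    ∃ j w, e i j = some w ∧ w.take u.length = u.take w.length := by
  -- The sequence `u000…` is not random, hence lies in `U i`.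
  have hz : (fun n => u.getD n false : Cantor) ∉ MLR := fun h =>
    const_false_notMem_MLR (mem_MLR_of_tail h (m := u.length) (l := 0) fun n => by simp)
  rw [hU.mlr_eq, Set.notMem_compl_iff, Set.mem_iInter] at hz
  have hi := hz i
  rw [he i] at hi
  obtain ⟨j, w, hj, hw⟩ := hi
  have hw' : initial (fun n => u.getD n false) w.length = w := hw
  refine ⟨j, w, hj, List.ext_getElem? fun n => ?_⟩
  rw [← hw']
  by_cases h1 : n < u.length <;> by_cases h2 : n < w.length <;>
    simp [h1, h2, initial]

/-! ### Reducing the Birkhoff rate to layers -/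

/-- One action of the machine `driveInto` below. Here `u` is the output so far, which is known to lie
in `U i` for all `i < r` and which shall be driven into `U i` for all `i < t`; `o` is a candidate for
a cylinder in `U r`, and `b` is the bit to be copied if `t` has been reached. -/
def driveIntoAction (o : Option (List Bool)) (u : List Bool) (r t : ℕ) (b : Bool) :
    List Bool × (ℕ × ℕ) :=
  if r < t then
    if o.isSome = true ∧ (o.getD []).take u.length = u.take (o.getD []).length then
      ((o.getD []).drop u.length, (r + 1, t))
    else ([], (r, t))
  else ([b], (r, t))

theorem primrec_driveIntoAction :
    Primrec fun x : Option (List Bool) × (List Bool × (ℕ × (ℕ × Bool))) =>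
      driveIntoAction x.1 x.2.1 x.2.2.1 x.2.2.2.1 x.2.2.2.2 := by
  have hu : Primrec fun x : Option (List Bool) × (List Bool × (ℕ × (ℕ × Bool))) => x.2.1 :=
    Primrec.fst.comp Primrec.snd
  have hr : Primrec fun x : Option (List Bool) × (List Bool × (ℕ × (ℕ × Bool))) => x.2.2.1 :=
    Primrec.fst.comp (Primrec.snd.comp Primrec.snd)
  have ht : Primrec fun x : Option (List Bool) × (List Bool × (ℕ × (ℕ × Bool))) => x.2.2.2.1 :=
    Primrec.fst.comp (Primrec.snd.comp (Primrec.snd.comp Primrec.snd))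
  have hb : Primrec fun x : Option (List Bool) × (List Bool × (ℕ × (ℕ × Bool))) => x.2.2.2.2 :=
    Primrec.snd.comp (Primrec.snd.comp (Primrec.snd.comp Primrec.snd))
  have hw : Primrec fun x : Option (List Bool) × (List Bool × (ℕ × (ℕ × Bool))) => x.1.getD [] :=
    Primrec.option_getD.comp Primrec.fst (Primrec.const [])
  refine Primrec.ite (Primrec.nat_lt.comp hr ht) (Primrec.ite (PrimrecPred.and ?_ ?_) ?_ ?_) ?_
  · exact Primrec.eq.comp (Primrec.option_isSome.comp Primrec.fst) (Primrec.const true)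
  · exact Primrec.eq.comp (Primrec.list_take.comp (Primrec.list_length.comp hu) hw)
      (Primrec.list_take.comp (Primrec.list_length.comp hw) hu)
  · exact (Primrec.list_drop.comp (Primrec.list_length.comp hu) hw).pair
      ((Primrec.succ.comp hr).pair ht)
  · exact (Primrec.const []).pair (hr.pair ht)
  · exact (Primrec.list_cons.comp hb (Primrec.const [])).pair (hr.pair ht)

/-- The target `t`, updated at time `s` on the prefix `v` of a name of `(p, k)`: it is raised to
`s + 1` if the prefix of length `s + 1` of `p` deviates. -/
def raisedTarget (s : ℕ) (v : List ℕ) (t : ℕ) : ℕ :=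
  if Deviates (v.getD 1 0) (initial (fun i => decide (v.getD (2 * i) 0 = 1)) (s + 1)) then
    max t (s + 1) else t

theorem primrec_raisedTarget :
    Primrec fun x : (ℕ × List ℕ) × ℕ => raisedTarget x.1.1 x.1.2 x.2 := by
  have hs : Primrec fun x : (ℕ × List ℕ) × ℕ => x.1.1 := Primrec.fst.comp Primrec.fst
  have hv : Primrec fun x : (ℕ × List ℕ) × ℕ => x.1.2 := Primrec.snd.comp Primrec.fst
  have hbit : Primrec₂ fun (x : (ℕ × List ℕ) × ℕ) (i : ℕ) =>
      decide (x.1.2.getD (2 * i) 0 = 1) :=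
    PrimrecPred.decide (Primrec.eq.comp ((Primrec.list_getD 0).comp (hv.comp Primrec.fst)
      (Primrec.nat_mul.comp (Primrec.const 2) Primrec.snd)) (Primrec.const 1))
  exact Primrec.ite (primrecRel_deviates.comp ((Primrec.list_getD 0).comp hv (Primrec.const 1))
    (primrec_initial hbit (Primrec.succ.comp hs)))
    (Primrec.nat_max.comp Primrec.snd (Primrec.succ.comp hs)) Primrec.snd

section DriveInto

variable {e : ℕ → ℕ → Option (List Bool)}

/-- The machine that reduces the Birkhoff rate to layers. It copies `p`, but whenever it sees that a
prefix of length `s + 1` of `p` deviates, it drives its output into `U 0, …, U s`. At time `s` it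
considers the candidate `e r s.unpair.1`, so that every candidate is considered infinitely often. -/
def driveInto (e : ℕ → ℕ → Option (List Bool)) : Transition (ℕ × ℕ) := fun s v st =>
  driveIntoAction (e st.2.1 s.unpair.1) st.1 st.2.1 (raisedTarget s v st.2.2)
    (decide (v.getD (2 * s) 0 = 1))

theorem computable_driveInto (he : Computable₂ e) :
    Computable fun x : (ℕ × List ℕ) × (List Bool × (ℕ × ℕ)) => driveInto e x.1.1 x.1.2 x.2 := by
  have hs : Primrec fun x : (ℕ × List ℕ) × (List Bool × (ℕ × ℕ)) => x.1.1 :=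
    Primrec.fst.comp Primrec.fst
  have hr : Primrec fun x : (ℕ × List ℕ) × (List Bool × (ℕ × ℕ)) => x.2.2.1 :=
    Primrec.fst.comp (Primrec.snd.comp Primrec.snd)
  have ht : Primrec fun x : (ℕ × List ℕ) × (List Bool × (ℕ × ℕ)) =>
      raisedTarget x.1.1 x.1.2 x.2.2.2 := by
    have h : Primrec fun x : (ℕ × List ℕ) × (List Bool × (ℕ × ℕ)) => (x.1, x.2.2.2) :=
      Primrec.fst.pair (Primrec.snd.comp (Primrec.snd.comp Primrec.snd))
    exact (primrec_raisedTarget.comp h).of_eq fun _ => rfl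
  have hb : Primrec fun x : (ℕ × List ℕ) × (List Bool × (ℕ × ℕ)) =>
      decide (x.1.2.getD (2 * x.1.1) 0 = 1) :=
    PrimrecPred.decide (Primrec.eq.comp ((Primrec.list_getD 0).comp
      (Primrec.snd.comp Primrec.fst) (Primrec.nat_mul.comp (Primrec.const 2) hs))
      (Primrec.const 1))
  have hin : Computable fun x : (ℕ × List ℕ) × (List Bool × (ℕ × ℕ)) =>
      (e x.2.2.1 x.1.1.unpair.1, (x.2.1, (x.2.2.1, (raisedTarget x.1.1 x.1.2 x.2.2.2,
        decide (x.1.2.getD (2 * x.1.1) 0 = 1))))) :=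
    (he.comp hr.to_comp (Primrec.fst.comp (Primrec.unpair.comp hs)).to_comp).pair
      ((Primrec.fst.comp Primrec.snd).pair (hr.pair (ht.pair hb))).to_comp
  exact (primrec_driveIntoAction.to_comp.comp hin).of_eq fun _ => rfl

variable {ν : Baire} {p : Cantor}

theorem driveInto_initial (hp : ∀ n, decide (ν (2 * n) = 1) = p n) (s : ℕ)
    (st : List Bool × (ℕ × ℕ)) :
    driveInto e s (initial ν (2 * s + 2)) st =
      driveIntoAction (e st.2.1 s.unpair.1) st.1 st.2.1
        (if Deviates (ν 1) (initial p (s + 1)) then max st.2.2 (s + 1) else st.2.2) (p s) := by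
  have h1 : (initial ν (2 * s + 2)).getD 1 0 = ν 1 := getD_initial ν (by omega) 0
  have h2 : (initial ν (2 * s + 2)).getD (2 * s) 0 = ν (2 * s) := getD_initial ν (by omega) 0
  have h3 : initial (fun i => decide ((initial ν (2 * s + 2)).getD (2 * i) 0 = 1)) (s + 1) =
      initial p (s + 1) := by
    refine List.map_congr_left fun i hi => ?_
    have : i < s + 1 := List.mem_range.1 hi
    rw [getD_initial ν (by omega) 0, hp]
  rw [driveInto, raisedTarget, h1, h2, h3, hp]

local notation "R" => run (driveInto e) (0, 0) ν

theorem driveInto_target (hp : ∀ n, decide (ν (2 * n) = 1) = p n) (s : ℕ) :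
    (R (s + 1)).2.2 =
      if Deviates (ν 1) (initial p (s + 1)) then max (R s).2.2 (s + 1) else (R s).2.2 := by
  rw [run, driveInto_initial hp, driveIntoAction]
  dsimp only
  split_ifs <;> rfl

/-- The three possible steps: the target is not reached, and the output enters the next `U r`; it
is not reached, and the output waits; it is reached, and the next bit is copied. -/
theorem driveInto_succ (hp : ∀ n, decide (ν (2 * n) = 1) = p n) (s : ℕ) :
    ((R s).2.1 < (R (s + 1)).2.2 ∧
      ((∃ w, e (R s).2.1 s.unpair.1 = some w ∧
          w.take (R s).1.length = (R s).1.take w.length ∧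
          (R (s + 1)).1 = (R s).1 ++ w.drop (R s).1.length ∧ (R (s + 1)).2.1 = (R s).2.1 + 1) ∨
        ((∀ w, e (R s).2.1 s.unpair.1 = some w → w.take (R s).1.length ≠ (R s).1.take w.length) ∧
          (R (s + 1)).1 = (R s).1 ∧ (R (s + 1)).2.1 = (R s).2.1))) ∨
    ((R (s + 1)).2.2 ≤ (R s).2.1 ∧ (R (s + 1)).1 = (R s).1 ++ [p s] ∧
      (R (s + 1)).2.1 = (R s).2.1) := by
  rw [driveInto_target hp, run, driveInto_initial hp, driveIntoAction]
  dsimp only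
  generalize (if Deviates (ν 1) (initial p (s + 1)) then max (R s).2.2 (s + 1)
    else (R s).2.2) = t
  by_cases h1 : (R s).2.1 < t
  · refine Or.inl ⟨h1, ?_⟩
    rw [if_pos h1]
    by_cases h2 : (e (R s).2.1 s.unpair.1).isSome = true ∧
        ((e (R s).2.1 s.unpair.1).getD []).take (R s).1.length =
          (R s).1.take ((e (R s).2.1 s.unpair.1).getD []).length
    · left
      rw [if_pos h2]
      obtain ⟨w, hw⟩ := Option.isSome_iff_exists.1 h2.1
      have h3 := h2.2
      rw [hw] at h3 ⊢
      exact ⟨w, rfl, h3, rfl, rfl⟩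
    · right
      rw [if_neg h2]
      refine ⟨fun w hw h => h2 ⟨?_, ?_⟩, List.append_nil _, rfl⟩
      · rw [hw, Option.isSome_some]
      · rw [hw, Option.getD_some]
        exact h
  · rw [if_neg h1]
    exact Or.inr ⟨not_lt.1 h1, rfl, rfl⟩

theorem driveInto_target_mono (hp : ∀ n, decide (ν (2 * n) = 1) = p n) :
    Monotone fun s => (R s).2.2 := by
  refine monotone_nat_of_le_succ fun s => ?_
  rw [driveInto_target hp]
  split_ifs
  · exact le_max_left _ _
  · exact le_rfl

theorem driveInto_reached_mono (hp : ∀ n, decide (ν (2 * n) = 1) = p n) :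
    Monotone fun s => (R s).2.1 := by
  refine monotone_nat_of_le_succ fun s => ?_
  rcases driveInto_succ (e := e) hp s with ⟨_, ⟨w, _, _, _, h⟩ | ⟨_, _, h⟩⟩ | ⟨_, _, h⟩ <;> omega

/-- The output lies in all `U i` that have been reached. -/
theorem driveInto_reached (hp : ∀ n, decide (ν (2 * n) = 1) = p n) (s i : ℕ)
    (hi : i < (R s).2.1) : ∃ j w, e i j = some w ∧ w <+: (R s).1 := by
  induction s with
  | zero => exact absurd hi (Nat.not_lt_zero i)
  | succ s ih =>
    by_cases h : i < (R s).2.1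
    · obtain ⟨j, w, hj, hw⟩ := ih h
      exact ⟨j, w, hj, hw.trans (run_prefix ν (Nat.le_succ s))⟩
    · rcases driveInto_succ (e := e) hp s with
        ⟨_, ⟨w, hw, hc, ho, hr⟩ | ⟨_, _, hr⟩⟩ | ⟨_, _, hr⟩
      · obtain rfl : i = (R s).2.1 := by omega
        refine ⟨_, w, hw, ?_⟩
        rw [ho]
        rcases le_total (R s).1.length w.length with hl | hl
        · rw [List.take_of_length_le hl] at hc
          rw [← hc, List.length_take, min_eq_left hl, List.take_append_drop]
        · rw [List.take_of_length_le hl] at hc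
          rw [List.drop_of_length_le hl, List.append_nil, hc]
          exact List.take_prefix _ _
      · omega
      · omega

/-- As long as the target has not been reached, the machine waits for a compatible cylinder, and by
density it finds one. -/
theorem driveInto_reached_unbounded (hp : ∀ n, decide (ν (2 * n) = 1) = p n)
    (hdense : ∀ i (u : List Bool), ∃ j w, e i j = some w ∧ w.take u.length = u.take w.length) {N : ℕ}
    (hlt : ∀ s ≥ N, (R s).2.1 < (R (s + 1)).2.2) (m : ℕ) : ∃ s ≥ N, m ≤ (R s).2.1 := by
  induction m with
  | zero => exact ⟨N, le_rfl, Nat.zero_le _⟩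
  | succ m ih =>
    obtain ⟨s, hs, hm⟩ := ih
    by_contra hno
    push Not at hno
    have hwait : ∀ s' ≥ s, (R s').1 = (R s).1 ∧ (R s').2.1 = (R s).2.1 := by
      intro s' hs'
      induction s', hs' using Nat.le_induction with
      | base => exact ⟨rfl, rfl⟩
      | succ s' hs' ih =>
        have h1 := hno (s' + 1) (by omega)
        rcases driveInto_succ (e := e) hp s' with
          ⟨_, ⟨w, _, _, _, hr⟩ | ⟨_, ho, hr⟩⟩ | ⟨hle, _, _⟩
        · omega
        · exact ⟨ho.trans ih.1, hr.trans ih.2⟩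
        · exact absurd (hlt s' (by omega)) (not_lt.2 hle)
    obtain ⟨j, w, hj, hw⟩ := hdense (R s).2.1 (R s).1
    have hj' : (Nat.pair j s).unpair.1 = j := by rw [Nat.unpair_pair]
    have hs' : s ≤ Nat.pair j s := Nat.right_le_pair j s
    obtain ⟨ho, hr⟩ := hwait _ hs'
    rcases driveInto_succ (e := e) hp (Nat.pair j s) with
      ⟨_, ⟨_, _, _, _, h⟩ | ⟨h, _, _⟩⟩ | ⟨h, _, _⟩
    · have := hno (Nat.pair j s + 1) (by omega)
      omega
    · rw [hj', ho, hr] at h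
      exact h w hj hw
    · exact absurd (hlt (Nat.pair j s) (by omega)) (not_lt.2 h)

/-- If only finitely many prefixes of `p` deviate, then the machine eventually just copies. -/
theorem driveInto_eventually_copy (hp : ∀ n, decide (ν (2 * n) = 1) = p n)
    (hdense : ∀ i (u : List Bool), ∃ j w, e i j = some w ∧ w.take u.length = u.take w.length) {N : ℕ}
    (hN : ∀ n ≥ N, ¬ Deviates (ν 1) (initial p (n + 1))) :
    ∃ s₀, ∀ s ≥ s₀, (R s).2.2 ≤ (R s).2.1 ∧ (R (s + 1)).1 = (R s).1 ++ [p s] := by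
  have htarget : ∀ s ≥ N, (R s).2.2 = (R N).2.2 := by
    intro s hs
    induction s, hs using Nat.le_induction with
    | base => rfl
    | succ s hs ih => rw [driveInto_target hp, if_neg (hN s hs), ih]
  obtain ⟨s₀, hs₀, hle⟩ : ∃ s ≥ N, (R (s + 1)).2.2 ≤ (R s).2.1 := by
    by_contra hno
    push Not at hno
    obtain ⟨s, hs, h⟩ := driveInto_reached_unbounded hp hdense hno (R N).2.2
    have h1 := hno s hs
    rw [htarget _ (by omega)] at h1
    omega
  refine ⟨s₀, fun s hs => ?_⟩
  have h1 := driveInto_reached_mono (e := e) hp hs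
  have h2 := htarget s (by omega)
  have h3 := htarget (s + 1) (by omega)
  have h4 := htarget (s₀ + 1) (by omega)
  dsimp only at h1
  rcases driveInto_succ (e := e) hp s with ⟨h, _⟩ | ⟨_, h, _⟩
  · omega
  · exact ⟨by omega, h⟩

end DriveInto

theorem tail_prefix_tail (v w : List ℕ) (h : v <+: w) : v.tail <+: w.tail := by
  rw [← List.drop_one, ← List.drop_one]
  exact h.drop 1

theorem isComputable_ofWord_tail : IsComputable (ofWord List.tail) :=
  isComputable_ofWord Primrec.list_tail.to_comp tail_prefix_tail

theorem mem_ofWord_tail (p : Baire) : (fun n => p (n + 1)) ∈ ofWord List.tail p :=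
  mem_ofWord tail_prefix_tail fun m => ⟨m + 2, by
    rw [List.getElem?_tail, getElem?_initial p (by omega)]⟩

theorem map_toNat_prefix (v w : List Bool) (h : v <+: w) :
    v.map Bool.toNat <+: w.map Bool.toNat := h.map _

/-- Given `(p, k)`, a layer of the output of the machine `driveInto` is a Birkhoff bound. -/
theorem Birkhoff_reducible_LAY {U : ℕ → Set Cantor} (hU : IsUniversalMLTest U) :
    Reducible Birkhoff (LAY U) := by
  obtain ⟨e, he, heU⟩ := hU.1.1
  have hdense := hU.exists_compatible heU
  refine ⟨ofWord List.tail, ofWord (machineWord (driveInto e) (0, 0) (List.map Bool.toNat)),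
    isComputable_ofWord_tail, isComputable_ofWord
      (computable_machineWord (computable_driveInto he)
        (Primrec.list_map Primrec.id ((Primrec.dom_bool _).comp Primrec.snd)))
      (machineWord_mono map_toNat_prefix), fun G hG ν x hx _ => ?_⟩
  obtain ⟨hx1, hx2⟩ := mem_rep_prod.1 hx
  have hp : ∀ n, decide (ν (2 * n) = 1) = (x.1 : Cantor) n := apply_of_mem_rep hx1
  have hk : x.2 = ν 1 := mem_rep_nat.1 hx2
  obtain ⟨N, hN⟩ := Birkhoff_nonempty x
  rw [mem_Birkhoff_iff, hk] at hN
  obtain ⟨s₀, hs₀⟩ := driveInto_eventually_copy hp hdense hN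
  obtain ⟨q, hq, hout, hlen⟩ :=
    exists_mem_MLR_of_eventually_copy x.1.2 fun s hs => (hs₀ s hs).2
  have hqH : cantorName q ∈
      ofWord (machineWord (driveInto e) (0, 0) (List.map Bool.toNat)) ν := by
    refine mem_ofWord (machineWord_mono map_toNat_prefix) fun m => ?_
    obtain ⟨s, hs⟩ := hlen m
    refine ⟨2 * s, ?_⟩
    rw [machineWord_initial, hout s, List.getElem?_map, getElem?_initial q hs]
    rfl
  have hne : (LAY U ⟨q, hq⟩).Nonempty := by
    have h := hq
    rw [hU.mlr_eq, Set.mem_compl_iff, Set.mem_iInter, not_forall] at h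
    exact h
  obtain ⟨y, hyG, n, hn, hny⟩ := hG _ _ (mem_rep_cantorName hq) hne
  refine ⟨_, Part.mem_bind hqH (Part.mem_bind hyG (mem_ofWord_tail _)), n, ?_, ?_⟩
  · rw [mem_rep_nat] at hn ⊢
    simp [pairing, hn]
  · refine mem_Birkhoff_iff.2 fun m hm hdev => hny ?_
    rw [hk] at hdev
    -- The late deviation forces the output `q` into `U n`.
    have ht : m + 1 ≤ (run (driveInto e) (0, 0) ν (m + 1)).2.2 := by
      rw [driveInto_target hp, if_pos hdev]
      exact le_max_right _ _
    have ht' := driveInto_target_mono (e := e) hp (le_max_left (m + 1) s₀)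
    have hr := (hs₀ _ (le_max_right (m + 1) s₀)).1
    obtain ⟨j, w, hj, hw⟩ := driveInto_reached (e := e) hp (max (m + 1) s₀) n (by
      dsimp only at ht'
      omega)
    rw [heU]
    refine ⟨j, w, hj, ?_⟩
    rw [hout] at hw
    exact (eq_initial_of_prefix hw).symm

/-! ### Reducing layers to the Birkhoff rate -/

/-- One action of the machine `markLayers` below. Here `u` is the output so far, `w` is the prefix of
length `s + 1` of the input, and `o` is a candidate for a cylinder in `U c`. If `w` lies in this
cylinder, the action appends enough zeros to make the output deviate at an index that is at least
`s`; otherwise it copies the bit `b`. -/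
def markLayersAction (o : Option (List Bool)) (s : ℕ) (w : List Bool) (b : Bool) (u : List Bool)
    (c : ℕ) : List Bool × ℕ :=
  if o.isSome = true ∧ w.take (o.getD []).length = o.getD [] then
    (initial (fun _ => false) (3 * u.length + s + 1), c + 1)
  else ([b], c)

theorem primrec_markLayersAction :
    Primrec fun x : Option (List Bool) × (ℕ × (List Bool × (Bool × (List Bool × ℕ)))) =>
      markLayersAction x.1 x.2.1 x.2.2.1 x.2.2.2.1 x.2.2.2.2.1 x.2.2.2.2.2 := by
  have hs : Primrec fun x : Option (List Bool) × (ℕ × (List Bool × (Bool × (List Bool × ℕ)))) =>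
      x.2.1 := Primrec.fst.comp Primrec.snd
  have hw : Primrec fun x : Option (List Bool) × (ℕ × (List Bool × (Bool × (List Bool × ℕ)))) =>
      x.2.2.1 := Primrec.fst.comp (Primrec.snd.comp Primrec.snd)
  have h3 : Primrec fun x : Option (List Bool) × (ℕ × (List Bool × (Bool × (List Bool × ℕ)))) =>
      x.2.2.2 := Primrec.snd.comp (Primrec.snd.comp Primrec.snd)
  have hb := Primrec.fst.comp h3
  have hu := Primrec.fst.comp (Primrec.snd.comp h3)
  have hc := Primrec.snd.comp (Primrec.snd.comp h3)
  have ho : Primrec fun x : Option (List Bool) × (ℕ × (List Bool × (Bool × (List Bool × ℕ)))) =>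
      x.1.getD [] := Primrec.option_getD.comp Primrec.fst (Primrec.const [])
  refine Primrec.ite (PrimrecPred.and ?_ ?_) (Primrec.pair ?_ (Primrec.succ.comp hc))
    ((Primrec.list_cons.comp hb (Primrec.const [])).pair hc)
  · exact Primrec.eq.comp (Primrec.option_isSome.comp Primrec.fst) (Primrec.const true)
  · exact Primrec.eq.comp (Primrec.list_take.comp (Primrec.list_length.comp ho) hw) ho
  · exact primrec_initial (Primrec.const false).to₂ (Primrec.succ.comp (Primrec.nat_add.comp
      (Primrec.nat_mul.comp (Primrec.const 3) (Primrec.list_length.comp hu)) hs))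

/-- The machine that reduces layers to the Birkhoff rate. It copies its input `p`. Its state is the
least number `c` such that `p` has not yet been seen to lie in `U c`, and every increase of `c` is
marked in the output by a deviation whose index is at least the present time. -/
def markLayers (e : ℕ → ℕ → Option (List Bool)) : Transition ℕ := fun s v st =>
  markLayersAction (e st.2 s.unpair.1) s (initial (fun i => decide (v.getD i 0 = 1)) (s + 1))
    (decide (v.getD s 0 = 1)) st.1 st.2

section MarkLayers

variable {e : ℕ → ℕ → Option (List Bool)}

theorem computable_markLayers (he : Computable₂ e) :
    Computable fun x : (ℕ × List ℕ) × (List Bool × ℕ) => markLayers e x.1.1 x.1.2 x.2 := by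
  have hs : Primrec fun x : (ℕ × List ℕ) × (List Bool × ℕ) => x.1.1 :=
    Primrec.fst.comp Primrec.fst
  have hc : Primrec fun x : (ℕ × List ℕ) × (List Bool × ℕ) => x.2.2 :=
    Primrec.snd.comp Primrec.snd
  have hbit : Primrec₂ fun (x : (ℕ × List ℕ) × (List Bool × ℕ)) (i : ℕ) =>
      decide (x.1.2.getD i 0 = 1) :=
    PrimrecPred.decide (Primrec.eq.comp ((Primrec.list_getD 0).comp
      ((Primrec.snd.comp Primrec.fst).comp Primrec.fst) Primrec.snd) (Primrec.const 1))
  have hin := (he.comp hc.to_comp (Primrec.fst.comp (Primrec.unpair.comp hs)).to_comp).pair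
    (hs.pair ((primrec_initial hbit (Primrec.succ.comp hs)).pair
      ((hbit.comp Primrec.id hs).pair Primrec.snd))).to_comp
  exact (primrec_markLayersAction.to_comp.comp hin).of_eq fun _ => rfl

variable {ν : Baire} {p : Cantor}

local notation "R" => run (markLayers e) 0 ν

theorem markLayers_succ (hp : ∀ n, decide (ν n = 1) = p n) (s : ℕ) :
    (∃ w, e (R s).2 s.unpair.1 = some w ∧ (initial p (s + 1)).take w.length = w ∧
      (R (s + 1)).1 = (R s).1 ++ initial (fun _ => false) (3 * (R s).1.length + s + 1) ∧
      (R (s + 1)).2 = (R s).2 + 1) ∨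
    ((∀ w, e (R s).2 s.unpair.1 = some w → (initial p (s + 1)).take w.length ≠ w) ∧
      (R (s + 1)).1 = (R s).1 ++ [p s] ∧ (R (s + 1)).2 = (R s).2) := by
  have h2 : (initial ν (2 * s + 2)).getD s 0 = ν s := getD_initial ν (by omega) 0
  have h3 : initial (fun i => decide ((initial ν (2 * s + 2)).getD i 0 = 1)) (s + 1) =
      initial p (s + 1) := by
    refine List.map_congr_left fun i hi => ?_
    have : i < s + 1 := List.mem_range.1 hi
    rw [getD_initial ν (by omega) 0, hp]
  rw [run, markLayers, h2, h3, hp, markLayersAction]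
  by_cases h : (e (R s).2 s.unpair.1).isSome = true ∧
      (initial p (s + 1)).take ((e (R s).2 s.unpair.1).getD []).length =
        (e (R s).2 s.unpair.1).getD []
  · left
    rw [if_pos h]
    obtain ⟨w, hw⟩ := Option.isSome_iff_exists.1 h.1
    have h' := h.2
    rw [hw] at h' ⊢
    exact ⟨w, rfl, h', rfl, rfl⟩
  · right
    rw [if_neg h]
    refine ⟨fun w hw h' => h ⟨?_, ?_⟩, rfl, rfl⟩
    · rw [hw, Option.isSome_some]
    · rw [hw, Option.getD_some]
      exact h'

theorem markLayers_mono (hp : ∀ n, decide (ν n = 1) = p n) : Monotone fun s => (R s).2 := by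
  refine monotone_nat_of_le_succ fun s => ?_
  rcases markLayers_succ (e := e) hp s with ⟨w, _, _, _, h⟩ | ⟨_, _, h⟩ <;> omega

theorem take_initial_iff {A : Type*} {q : ℕ → A} {n : ℕ} {w : List A} :
    (initial q n).take w.length = w ↔ w.length ≤ n ∧ initial q w.length = w := by
  constructor
  · intro h
    have hw : w <+: initial q n := h ▸ List.take_prefix _ _
    exact ⟨by simpa using hw.length_le, (eq_initial_of_prefix hw).symm⟩
  · rintro ⟨hl, h⟩
    exact (List.prefix_iff_eq_take.1 (h ▸ by simpa using initial_prefix q hl)).symm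

/-- The sequence `p` lies in `U i` for all `i` below the state. -/
theorem markLayers_sound (hp : ∀ n, decide (ν n = 1) = p n) (s i : ℕ) (hi : i < (R s).2) :
    ∃ j w, e i j = some w ∧ p ∈ cylinder w := by
  induction s with
  | zero => exact absurd hi (Nat.not_lt_zero i)
  | succ s ih =>
    by_cases h : i < (R s).2
    · exact ih h
    · rcases markLayers_succ (e := e) hp s with ⟨w, hw, hc, _, hr⟩ | ⟨_, _, hr⟩
      · obtain rfl : i = (R s).2 := by omega
        exact ⟨_, w, hw, (take_initial_iff.1 hc).2⟩
      · omega

/-- A final state is the index of a layer that avoids `p`. -/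
theorem markLayers_complete (hp : ∀ n, decide (ν n = 1) = p n) {s₀ : ℕ}
    (hs₀ : ∀ s ≥ s₀, (R s).2 = (R s₀).2) (j : ℕ) (w : List Bool) (hj : e (R s₀).2 j = some w) :
    p ∉ cylinder w := by
  intro hw
  set s := Nat.pair j (max s₀ w.length) with hs
  have hle : max s₀ w.length ≤ s := Nat.right_le_pair _ _
  have hj' : s.unpair.1 = j := by rw [hs, Nat.unpair_pair]
  have h0 := hs₀ s (by omega)
  have h1 := hs₀ (s + 1) (by omega)
  rcases markLayers_succ (e := e) hp s with ⟨_, _, _, _, h⟩ | ⟨h, _, _⟩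
  · omega
  · rw [hj', h0] at h
    exact h w hj (take_initial_iff.2 ⟨by omega, hw⟩)

/-- Every change of the state at a time `s` makes the output deviate at an index that is at
least `s`. -/
theorem deviates_of_markLayers_change (hp : ∀ n, decide (ν n = 1) = p n) {q : Cantor}
    (hq : ∀ s, (R s).1 = initial q (R s).1.length) {s : ℕ} (h : (R (s + 1)).2 ≠ (R s).2) :
    ∃ n ≥ s, Deviates 2 (initial q (n + 1)) := by
  rcases markLayers_succ (e := e) hp s with ⟨_, _, _, ho, _⟩ | ⟨_, _, h'⟩
  · refine ⟨4 * (R s).1.length + s, by omega, Or.inr ?_⟩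
    have hlen : (R (s + 1)).1.length = 4 * (R s).1.length + s + 1 := by
      rw [ho, List.length_append, length_initial]
      omega
    rw [← hlen, ← hq, hlen, ho, List.count_append,
      List.count_eq_zero.2 (show true ∉ initial (fun _ => false) _ by simp [initial]), add_zero]
    have := List.count_le_length (a := true) (l := (R s).1)
    omega
  · exact absurd h' h

end MarkLayers

/-- The word function that encodes a binary sequence `q` into a name of `(q, 2)`. -/
def pairWithTwo (w : List Bool) : List ℕ := w.flatMap fun b => [b.toNat, 2]

theorem primrec_pairWithTwo : Primrec pairWithTwo :=
  Primrec.list_flatMap Primrec.id ((Primrec.dom_bool fun b => [b.toNat, 2]).comp Primrec.snd)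

theorem pairWithTwo_prefix (v w : List Bool) (h : v <+: w) : pairWithTwo v <+: pairWithTwo w := by
  obtain ⟨t, rfl⟩ := h
  exact ⟨pairWithTwo t, List.flatMap_append.symm⟩

theorem pairWithTwo_initial (q : Cantor) (n : ℕ) :
    pairWithTwo (initial q n) = initial (pairing (cantorName q) fun _ => 2) (2 * n) := by
  induction n with
  | zero => rfl
  | succ n ih =>
    have h1 : pairing (cantorName q) (fun _ => 2) (2 * n) = (q n).toNat := by
      simp [pairing, cantorName]
    have h2 : pairing (cantorName q) (fun _ => 2) (2 * n + 1) = 2 := by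
      simp [pairing]
    rw [initial_succ, Nat.mul_succ, initial_succ, initial_succ, h1, h2, ← ih]
    simp [pairWithTwo]

/-- The word function that reads a name of `p` paired with a name of `N`, and prepends the state of
the machine `markLayers` after `N` steps on `p`, as soon as the input is long enough to compute
it. -/
def stateWord (e : ℕ → ℕ → Option (List Bool)) (v : List ℕ) : List ℕ :=
  if 4 * v.getD 1 0 + 2 ≤ v.length then
    (run (markLayers e) 0 (fun i => v.getD (2 * i) 0) (v.getD 1 0)).2 :: v
  else []

theorem computable_stateWord {e : ℕ → ℕ → Option (List Bool)} (he : Computable₂ e) :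
    Computable (stateWord e) := by
  have h1 : Primrec fun v : List ℕ => v.getD 1 0 :=
    (Primrec.list_getD 0).comp Primrec.id (Primrec.const 1)
  have hf : Primrec₂ fun (v : List ℕ) (i : ℕ) => v.getD (2 * i) 0 :=
    (Primrec.list_getD 0).comp Primrec.fst (Primrec.nat_mul.comp (Primrec.const 2) Primrec.snd)
  have hc : Primrec fun v : List ℕ => decide (4 * v.getD 1 0 + 2 ≤ v.length) :=
    PrimrecPred.decide (Primrec.nat_le.comp (Primrec.nat_add.comp
      (Primrec.nat_mul.comp (Primrec.const 4) h1) (Primrec.const 2)) Primrec.list_length)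
  refine (Computable.cond hc.to_comp (Computable.list_cons.comp (Computable.snd.comp
    (computable_run (c₀ := 0) (computable_markLayers he) hf h1)) Computable.id)
    (Computable.const [])).of_eq fun v => ?_
  rw [Bool.cond_decide]
  rfl

theorem stateWord_mono (e : ℕ → ℕ → Option (List Bool)) (v w : List ℕ) (h : v <+: w) :
    stateWord e v <+: stateWord e w := by
  by_cases hv : 4 * v.getD 1 0 + 2 ≤ v.length
  · have h1 : w.getD 1 0 = v.getD 1 0 := getD_of_prefix h (by omega) 0
    have hw : 4 * w.getD 1 0 + 2 ≤ w.length := by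
      rw [h1]
      exact hv.trans h.length_le
    rw [stateWord, stateWord, if_pos hv, if_pos hw, h1,
      run_congr (ν := fun i => w.getD (2 * i) 0) (ν' := fun i => v.getD (2 * i) 0) fun i hi =>
        getD_of_prefix h (by omega) 0]
    exact (List.prefix_cons_inj _).2 h
  · rw [stateWord, if_neg hv]
    exact List.nil_prefix

theorem exists_mem_ofWord_stateWord (e : ℕ → ℕ → Option (List Bool)) (ν μ : Baire) :
    ∃ r ∈ ofWord (stateWord e) (pairing ν μ), r 0 = (run (markLayers e) 0 ν (μ 0)).2 := by
  set c := (run (markLayers e) 0 ν (μ 0)).2 with hc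
  refine ⟨fun n => Nat.casesOn n c (pairing ν μ), mem_ofWord (stateWord_mono e) fun m =>
    ⟨4 * μ 0 + 2 + m, ?_⟩, rfl⟩
  have h1 : (initial (pairing ν μ) (4 * μ 0 + 2 + m)).getD 1 0 = μ 0 := by
    rw [getD_initial _ (by omega)]
    simp [pairing]
  rw [stateWord, h1, length_initial, if_pos (by omega),
    run_congr (ν' := ν) fun i hi => ?_]
  · cases m with
    | zero => rfl
    | succ m =>
      rw [List.getElem?_cons_succ, getElem?_initial _ (by omega)]
  · rw [getD_initial _ (by omega)]
    simp [pairing]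

/-- Given a random `x`, the state of the machine `markLayers` is final from the Birkhoff bound of its
output on, and a final state is a layer of `x`. -/
theorem LAY_reducible_Birkhoff {U : ℕ → Set Cantor} (hU : IsMLTest U) :
    Reducible (LAY U) Birkhoff := by
  obtain ⟨e, he, heU⟩ := hU.1
  refine ⟨ofWord (stateWord e), ofWord (machineWord (markLayers e) 0 pairWithTwo),
    isComputable_ofWord (computable_stateWord he) (stateWord_mono e), isComputable_ofWord
      (computable_machineWord (computable_markLayers he) primrec_pairWithTwo)
      (machineWord_mono pairWithTwo_prefix), fun G hG ν x hx _ => ?_⟩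
  have hp : ∀ n, decide (ν n = 1) = (x : Cantor) n := apply_of_mem_rep hx
  -- Since `x` is random, the state of the machine cannot grow forever.
  obtain ⟨i, hi⟩ : ∃ i, (x : Cantor) ∉ U i := by
    by_contra h
    push Not at h
    exact x.2 U hU (Set.mem_iInter.2 h)
  have hbdd : ∀ s, (run (markLayers e) 0 ν s).2 ≤ i := fun s => by
    by_contra h
    rw [heU] at hi
    exact hi (markLayers_sound hp s i (not_le.1 h))
  obtain ⟨c, s₀, hs₀⟩ := converges_of_monotone_of_bounded (markLayers_mono (e := e) hp) hbdd
  obtain ⟨q, hq, hout, hlen⟩ := exists_mem_MLR_of_eventually_copy (step := markLayers e) (c₀ := 0)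
    (ν := ν) (s₀ := s₀) x.2 fun s hs => by
      have h0 := hs₀ s hs
      have h1 := hs₀ (s + 1) (by omega)
      rcases markLayers_succ (e := e) hp s with ⟨_, _, _, _, h⟩ | ⟨_, h, _⟩
      · omega
      · exact h
  have hqH : pairing (cantorName q) (fun _ => 2) ∈
      ofWord (machineWord (markLayers e) 0 pairWithTwo) ν := by
    refine mem_ofWord (machineWord_mono pairWithTwo_prefix) fun m => ?_
    obtain ⟨s, hs⟩ := hlen m
    refine ⟨2 * s, ?_⟩
    rw [machineWord_initial, hout s, pairWithTwo_initial, getElem?_initial _ (by omega)]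
  have hname : ((⟨q, hq⟩ : MLR), 2) ∈ Represented.rep (X := MLR × ℕ)
      (pairing (cantorName q) fun _ => 2) := by
    rw [mem_rep_prod, evenPart_pairing, oddPart_pairing]
    exact ⟨mem_rep_cantorName hq, mem_rep_nat.2 rfl⟩
  obtain ⟨μ, hμ, N, hN, hNB⟩ := hG _ _ hname (Birkhoff_nonempty _)
  rw [mem_rep_nat] at hN
  rw [mem_Birkhoff_iff] at hNB
  -- After time `N` the state is final, since a change would cause a deviation of `q`.
  have hfinal : ∀ s ≥ N, (run (markLayers e) 0 ν s).2 = (run (markLayers e) 0 ν N).2 := by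
    intro s hs
    induction s, hs using Nat.le_induction with
    | base => rfl
    | succ s hs ih =>
      rw [← ih]
      by_contra h
      obtain ⟨n, hn, hdev⟩ := deviates_of_markLayers_change hp hout h
      exact hNB n (hs.trans hn) hdev
  obtain ⟨r, hr, hr0⟩ := exists_mem_ofWord_stateWord e ν μ
  refine ⟨r, Part.mem_bind hqH (Part.mem_bind hμ hr), r 0, mem_rep_nat.2 rfl, ?_⟩
  rw [hr0, ← hN, LAY, Set.mem_ofPred_eq, heU]
  rintro ⟨j, w, hj, hw⟩
  exact markLayers_complete hp hfinal j w hj hw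

end Weihrauch

theorem theorem25 (U : ℕ → Set Weihrauch.Cantor) (hU : Weihrauch.IsUniversalMLTest U) :
    (∀ x : Weihrauch.MLR × ℕ, (Weihrauch.Birkhoff x).Nonempty) ∧
      Weihrauch.Equivalent Weihrauch.Birkhoff (Weihrauch.LAY U) :=
  ⟨Weihrauch.Birkhoff_nonempty, Weihrauch.Birkhoff_reducible_LAY hU,
    Weihrauch.LAY_reducible_Birkhoff hU.1⟩
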